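/- **Theorem (suboptimality of bid aggregation).** *Market.* There is one transmission system operator (TSO), indexed by $0$, and finitely many distribution system operators (DSOs) $m\in\mathcal N^{\mathrm D}$. Network $m$ has a finite set of busses, upward and downward bids located at busses with positive prices $c^u_{m,n},c^d_{m,n}$, base injections $e_{m,k}$, a real matrix $C_m$ that maps nodal injections to line flows, and flow limits $f^{\min}_m,f^{\max}_m$. A local decision is $x_m=(u_m,d_m,p_m)$ (upward volumes, downward volumes, net injections), with cost $c_m^\top x_m=\sum_n c^u_{m,n}u_{m,n}-\sum_n c^d_{m,n}d_{m,n}$. Each DSO $m$ is connected through its root bus to one transmission bus $k_m$, distinct DSOs having distinct transmission busses, with interface flow $z_m\in[z_m^{\min},z_m^{\max}]$. The *DSO constraints at $z_m$* are: at every bus $k$ of network $m$, $\sum_{n\text{ at }k}u_{m,n}-\sum_{n\text{ at }k}d_{m,n}-p_{m,k}-[k\text{ is the root}]\,z_m=e_{m,k}$; $f_m^{\min}\le C_mp_m\le f_m^{\max}$; $0\le u_m\le u_m^{\max}$; $0\le d_m\le d_m^{\max}$. The *TSO constraints at $z$* are: at every transmission bus $k$, $\sum_{n\text{ at }k}u_{0,n}-\sum_{n\text{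 at }k}d_{0,n}-p_{0,k}+\sum_{m:\,k_m=k}z_m=e_{0,k}$, together with $f_0^{\min}\le C_0p_0\le f_0^{\max}$, $0\le u_0\le u_0^{\max}$, $0\le d_0\le d_0^{\max}$. Call $z_m$ *feasible for DSO $m$* if $z_m\in[z_m^{\min},z_m^{\max}]$ and some $x_m$ satisfies the DSO constraints at $z_m$. *Common market problem.* Minimize $J^{\mathrm{tot}}=c_0^\top x_0+\sum_m c_m^\top x_m$ over all $(x_0,(x_m,z_m)_m)$ that satisfy the TSO constraints at $z$ and, for every $m$, the DSO constraints at $z_m$ and $z_m\in[z_m^{\min},z_m^{\max}]$. *Bid aggregation method.* Each DSO $m$ chooses $\mathcal Z_m=\{z_{m,1}<\dots<z_{m,N_m}\}\subset[z_m^{\min},z_m^{\max}]$, $1\le N_m<\infty$. For each $\hat z\in\mathcal Z_m$ it minimizes $c_m^\top x_m$ under the DSO constraints at $\hat z$; infeasible $\hat z$ are discarded, which leaves $\mathcal Z_m^\star$, and the residual supply function $f^{\mathrm r}_m(\hat z)$ is the optimal value. The TSO minimizes $c_0^\top x_0+\sum_m f_m^{\mathrm r}(z_m)$ under the TSO constraints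 at $z$ and $z_m\in\mathcal Z_m^\star$ for all $m$. An *outcome* is a solution $(\hat x_0,\hat z)$ of this problem together with, for each $m$, a minimizer $\hat x_m$ of $c_m^\top x_m$ under the DSO constraints at $\hat z_m$. Its total cost is $c_0^\top\hat x_0+\sum_m c_m^\top\hat x_m$. Let $\delta_m=\max_{2\le k\le N_m}|z_{m,k}-z_{m,k-1}|$ ($0$ if $N_m=1$) and $\bar\delta=\max_m\delta_m$ ($0$ if there is no DSO). *Assumptions.* (i) Each DSO has a feasible interface flow. (ii) Whenever every $z_m$ is feasible for DSO $m$, some $x_0$ satisfies the TSO constraints at $z$; that is, the TSO can meet its needs from transmission-level bids only. *Conclusion.* The common market problem has an optimal value $J^\circ$, attained by a solution, and there is a constant $C\ge0$, depending only on the market data and not on the discretization, such that for all discretizations $(\mathcal Z_m)_m$ that reach the ends of the interface flow ranges up to $\bar\delta$, i.e. $z_{m,1}-z_m^{\min}\le\bar\delta$ and $z_m^{\max}-z_{m,N_m}\le\bar\delta$ for all $m$: if every $\mathcal Z_m^\star$ is nonempty, the method has an outcome; and the total cost $\hat J$ of every outcome satisfies $$0\le \hat J-J^\circ\le C\,\bar\delta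 .$$ -/

import Mathlib

namespace FlexMarket

/-- A distribution or transmission network with its flexibility bids.  Busses, upward providers,
downward providers and lines are numbered. -/
structure Network where
  nBus : ℕ
  nUp : ℕ
  nDown : ℕ
  nLine : ℕ
  /-- bus at which an upward provider is located -/
  upBus : Fin nUp → Fin nBus
  /-- bus at which a downward provider is located -/
  downBus : Fin nDown → Fin nBus
  /-- net anticipated base injection of each bus -/
  base : Fin nBus → ℝ
  /-- upward bid prices -/
  cUp : Fin nUp → ℝ
  /-- downward bid prices -/
  cDown : Fin nDown → ℝ
  cUp_pos : ∀ n, 0 < cUp n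
  cDown_pos : ∀ n, 0 < cDown n
  uMax : Fin nUp → ℝ
  dMax : Fin nDown → ℝ
  /-- sensitivity matrix from nodal injections to line flows -/
  sens : Matrix (Fin nLine) (Fin nBus) ℝ
  fMin : Fin nLine → ℝ
  fMax : Fin nLine → ℝ

namespace Network

/-- A local decision `x = (u, d, p)`: cleared upward volumes, cleared downward volumes, and net
injected powers of the busses. -/
abbrev Decision (N : Network) : Type :=
  (Fin N.nUp → ℝ) × (Fin N.nDown → ℝ) × (Fin N.nBus → ℝ)

/-- The procurement cost `c⊤ x`, with `c = col(cᵘ, -cᵈ, 0)`. -/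
def cost (N : Network) (x : N.Decision) : ℝ :=
  ∑ n, N.cUp n * x.1 n - ∑ n, N.cDown n * x.2.1 n

/-- Upward minus downward cleared volume minus net injection at bus `k`. -/
def nodal (N : Network) (x : N.Decision) (k : Fin N.nBus) : ℝ :=
  (∑ n with N.upBus n = k, x.1 n) - (∑ n with N.downBus n = k, x.2.1 n) - x.2.2 k

/-- Line flow limits. -/
def FlowLimits (N : Network) (x : N.Decision) : Prop :=
  ∀ l, N.sens.mulVec x.2.2 l ∈ Set.Icc (N.fMin l) (N.fMax l)

/-- Bid capacity limits. -/
def BidLimits (N : Network) (x : N.Decision) : Prop :=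
  (∀ n, x.1 n ∈ Set.Icc 0 (N.uMax n)) ∧ (∀ n, x.2.1 n ∈ Set.Icc 0 (N.dMax n))

end Network

/-- The network of a distribution system operator, with the bus at which it is connected to the
transmission network and the bounds of its interface flow. -/
structure DSO extends Network where
  root : Fin nBus
  zMin : ℝ
  zMax : ℝ

namespace DSO

/-- The power balance of every bus, for the interface flow `z`. -/
def Balance (D : DSO) (x : D.Decision) (z : ℝ) : Prop :=
  ∀ k, D.nodal x k - (if k = D.root then z else 0) = D.base k

/-- The network constraints of the DSO for the interface flow `z`, bounds of `z` not included. -/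
def GridFeasible (D : DSO) (x : D.Decision) (z : ℝ) : Prop :=
  D.Balance x z ∧ D.FlowLimits x ∧ D.BidLimits x

/-- The constraints of the local market problem of the DSO. -/
def Feasible (D : DSO) (x : D.Decision) (z : ℝ) : Prop :=
  D.GridFeasible x z ∧ z ∈ Set.Icc D.zMin D.zMax

/-- The objective of the local market problem of the DSO, with interface flow price `cz`. -/
def objective (D : DSO) (cz : ℝ) (x : D.Decision) (z : ℝ) : ℝ :=
  D.cost x + cz * z

/-- `x` solves the local market problem with interface price `0` and interface flow fixed to
`z`. -/
def SolvesFixed (D : DSO) (z : ℝ) (x : D.Decision) : Prop :=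
  D.GridFeasible x z ∧ IsMinOn (fun y => D.objective 0 y z) {y | D.GridFeasible y z} x

/-- The residual supply function: the optimal value of the local market problem with interface
price `0` and interface flow fixed to `z`.  It is used only for those `z` for which this problem
is feasible; its feasible set is then compact, up to the injections, which are determined by the
other variables, so that the infimum is a minimum. -/
noncomputable def rsf (D : DSO) (z : ℝ) : ℝ :=
  sInf ((fun x => D.objective 0 x z) '' {x | D.GridFeasible x z})

end DSO

/-- An ordered finite set `pt 0 < pt 1 < ⋯ < pt n` of discretized interface flows in `[a, b]`. -/
structure Grid (a b : ℝ) where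
  n : ℕ
  pt : Fin (n + 1) → ℝ
  strictMono : StrictMono pt
  mem : ∀ i, pt i ∈ Set.Icc a b

/-- The largest distance between two consecutive elements (`0` for a one-point set). -/
noncomputable def Grid.step {a b : ℝ} (Z : Grid a b) : ℝ :=
  ⨆ i : Fin Z.n, |Z.pt i.succ - Z.pt i.castSucc|

/-- The discretized interface flows for which the local market problem of the DSO with that fixed
interface flow is feasible. -/
def DSO.feasibleFlows (D : DSO) (Z : Grid D.zMin D.zMax) : Set ℝ :=
  {z | z ∈ Set.range Z.pt ∧ ∃ x, D.GridFeasible x z}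

/-- A transmission network and `nD` distribution networks, each of which has one interconnection
point, the transmission bus `conn m`; distinct DSOs have distinct transmission busses. -/
structure Market where
  nD : ℕ
  tso : Network
  dso : Fin nD → DSO
  conn : Fin nD → Fin tso.nBus
  conn_injective : Function.Injective conn

namespace Market

/-- The constraints of the transmission system operator, for the interface flows `z`.  Bus `k`
receives the interface flow of the DSO connected to it, if there is one. -/
def TsoFeasible (M : Market) (x₀ : M.tso.Decision) (z : Fin M.nD → ℝ) : Prop :=
  (∀ k, M.tso.nodal x₀ k + (∑ m with M.conn m = k, z m) = M.tso.base k) ∧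
    M.tso.FlowLimits x₀ ∧ M.tso.BidLimits x₀

/-- A joint decision `(x₀, (x_m), (z_m))`. -/
abbrev Joint (M : Market) : Type :=
  M.tso.Decision × ((m : Fin M.nD) → (M.dso m).Decision) × (Fin M.nD → ℝ)

/-- The total cost `c₀⊤ x₀ + ∑ c_m⊤ x_m`. -/
def totalCost (M : Market) (w : M.Joint) : ℝ :=
  M.tso.cost w.1 + ∑ m, (M.dso m).cost (w.2.1 m)

/-- The feasible set of the common market problem. -/
def commonFeasible (M : Market) : Set M.Joint :=
  {w | M.TsoFeasible w.1 w.2.2 ∧ ∀ m, (M.dso m).Feasible (w.2.1 m) (w.2.2 m)}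

/-- A choice of discretized interface flows for every DSO. -/
abbrev Discretization (M : Market) : Type :=
  (m : Fin M.nD) → Grid (M.dso m).zMin (M.dso m).zMax

/-- The largest step size over all DSOs. -/
noncomputable def maxStep (M : Market) (Z : M.Discretization) : ℝ :=
  ⨆ m, (Z m).step

/-- The feasible set of the transmission market problem with residual supply functions. -/
def rsfFeasible (M : Market) (Z : M.Discretization) :
    Set (M.tso.Decision × (Fin M.nD → ℝ)) :=
  {v | M.TsoFeasible v.1 v.2 ∧ ∀ m, v.2 m ∈ (M.dso m).feasibleFlows (Z m)}

/-- The objective of the transmission market problem with residual supply functions. -/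
noncomputable def rsfObjective (M : Market) (v : M.tso.Decision × (Fin M.nD → ℝ)) : ℝ :=
  M.tso.cost v.1 + ∑ m, (M.dso m).rsf (v.2 m)

/-- `w = (x₀, (x_m), (z_m))` is an outcome of the bid aggregation method: `(x₀, z)` solves the
transmission market problem with residual supply functions, and then every DSO clears a solution
of its local market problem with interface flow fixed to `z_m`. -/
def IsBidAggregationOutcome (M : Market) (Z : M.Discretization) (w : M.Joint) : Prop :=
  (w.1, w.2.2) ∈ M.rsfFeasible Z ∧ IsMinOn M.rsfObjective (M.rsfFeasible Z) (w.1, w.2.2) ∧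
    ∀ m, (M.dso m).SolvesFixed (w.2.2 m) (w.2.1 m)

/-- Up to the largest step size, the discretized flows reach both ends of the interface flow
range of every DSO. -/
def Covers (M : Market) (Z : M.Discretization) : Prop :=
  ∀ m, (Z m).pt 0 - (M.dso m).zMin ≤ M.maxStep Z ∧
    (M.dso m).zMax - (Z m).pt (Fin.last (Z m).n) ≤ M.maxStep Z

/-- Whatever feasible interface flows result from the local markets, the TSO can meet its needs
from transmission-level bids only. -/
def TsoSelfSufficient (M : Market) : Prop :=
  ∀ z : Fin M.nD → ℝ, (∀ m, ∃ x, (M.dso m).Feasible x (z m)) → ∃ x₀, M.TsoFeasible x₀ z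

end Market

end FlexMarket

/-! With polyhedral constraints and linear costs, the optimal value of the common market problem, as
a function of the fixed interface flows `z`, is Lipschitz where it is finite. By Fourier–Motzkin
elimination its epigraph is cut out by finitely many inequalities, and their slopes give the
constant (`IsPolyhedral.exists_lipschitz`). The same projection argument gives attainment without
compactness (`IsPolyhedral.exists_isMinOn`).

The feasible flows of a DSO form an interval. An outcome shows that this interval contains a grid
point, so the optimal flow has a feasible grid point within the largest step
(`Grid.exists_abs_sub_le`). Self-sufficiency of the TSO makes these rounded flows jointly feasible.
The Lipschitz bound prices the rounding, and an outcome is at least as cheap as any joint decision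
on the grid. -/

/-- A set that is cut out by finitely many non-strict linear inequalities. -/
def IsPolyhedral {E : Type*} [AddCommGroup E] [Module ℝ E] (S : Set E) : Prop :=
  ∃ (ι : Type) (_ : Finite ι) (f : ι → E →ₗ[ℝ] ℝ) (b : ι → ℝ), S = {x | ∀ i, f i x ≤ b i}

/-! ### Polyhedral sets, elimination of variables, parametric linear programs. -/

namespace IsPolyhedral

variable {E F : Type*} [AddCommGroup E] [Module ℝ E] [AddCommGroup F] [Module ℝ F]

theorem setOf_le {f : E → ℝ} (hf : IsLinearMap ℝ f) (b : ℝ) : IsPolyhedral {x | f x ≤ b} :=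
  ⟨Unit, inferInstance, fun _ => hf.mk' f, fun _ => b, by ext; simp⟩

theorem iInter {ι : Type} [Finite ι] {S : ι → Set E} (h : ∀ i, IsPolyhedral (S i)) :
    IsPolyhedral {x | ∀ i, x ∈ S i} := by
  choose κ hκ f b hS using h
  refine ⟨Σ i, κ i, inferInstance, fun p => f p.1 p.2, fun p => b p.1 p.2, ?_⟩
  ext x
  simp [hS, Sigma.forall]

theorem inter {S T : Set E} (hS : IsPolyhedral S) (hT : IsPolyhedral T) :
    IsPolyhedral {x | x ∈ S ∧ x ∈ T} := by
  obtain ⟨ι, hι, f, b, rfl⟩ := hS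
  obtain ⟨κ, hκ, g, c, rfl⟩ := hT
  refine ⟨ι ⊕ κ, inferInstance, Sum.elim f g, Sum.elim b c, ?_⟩
  ext x
  simp

theorem preimage {S : Set F} (hS : IsPolyhedral S) (g : E →ₗ[ℝ] F) :
    IsPolyhedral {x | g x ∈ S} := by
  obtain ⟨ι, hι, f, b, rfl⟩ := hS
  exact ⟨ι, hι, fun i => (f i).comp g, b, by ext; simp⟩

theorem setOf_ge {f : E → ℝ} (hf : IsLinearMap ℝ f) (b : ℝ) : IsPolyhedral {x | b ≤ f x} := by
  have h : IsLinearMap ℝ fun x => -f x :=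
    ⟨fun x y => by rw [hf.map_add]; ring, fun c x => by rw [hf.map_smul]; simp⟩
  simpa using setOf_le h (-b)

theorem setOf_mem_Icc {f : E → ℝ} (hf : IsLinearMap ℝ f) (a b : ℝ) :
    IsPolyhedral {x | f x ∈ Set.Icc a b} :=
  (setOf_ge hf a).inter (setOf_le hf b)

theorem setOf_eq {f : E → ℝ} (hf : IsLinearMap ℝ f) (b : ℝ) : IsPolyhedral {x | f x = b} := by
  simpa using setOf_mem_Icc hf b b

/-- Finitely many lower bounds, none of which exceeds any of finitely many upper bounds, admit a
common point. -/
theorem exists_between_of_finite {ι κ : Type} [Finite ι] [Finite κ] (l : ι → ℝ) (u : κ → ℝ)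
    (h : ∀ i j, l i ≤ u j) : ∃ t, (∀ i, l i ≤ t) ∧ ∀ j, t ≤ u j := by
  rcases isEmpty_or_nonempty ι with hι | hι
  · rcases isEmpty_or_nonempty κ with hκ | hκ
    · exact ⟨0, fun i => hι.elim i, fun j => hκ.elim j⟩
    · obtain ⟨j, hj⟩ := Finite.exists_min u
      exact ⟨u j, fun i => hι.elim i, hj⟩
  · obtain ⟨i, hi⟩ := Finite.exists_max l
    exact ⟨l i, hi, h i⟩

/-- Fourier–Motzkin elimination of one real variable. -/
theorem exists_real {S : Set (ℝ × E)} (hS : IsPolyhedral S) :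
    IsPolyhedral {y | ∃ t, (t, y) ∈ S} := by
  obtain ⟨ι, hι, f, b, rfl⟩ := hS
  set c : ι → ℝ := fun i => f i (1, 0) with hc
  set g : ι → E →ₗ[ℝ] ℝ := fun i => (f i).comp (LinearMap.inr ℝ ℝ E) with hg
  have hf : ∀ i t y, f i (t, y) = t * c i + g i y := by
    intro i t y
    have : ((t, y) : ℝ × E) = t • ((1, 0) : ℝ × E) + (0, y) := by simp
    rw [this, map_add, map_smul]
    simp [hc, hg]
  -- Rows free of `t` are kept; each lower bound on `t` is paired with each upper bound, cleared of
  -- denominators.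
  refine ⟨{i // c i = 0} ⊕ ({i // c i < 0} × {i // 0 < c i}), inferInstance,
    Sum.elim (fun i => g i) (fun p => c p.2 • g p.1 - c p.1 • g p.2),
    Sum.elim (fun i => b i) (fun p => c p.2 * b p.1 - c p.1 * b p.2), ?_⟩
  ext y
  simp only [Set.mem_ofPred_eq, hf]
  constructor
  · rintro ⟨t, ht⟩ (⟨i, hi⟩ | ⟨⟨i, hi⟩, ⟨j, hj⟩⟩)
    · simpa [hi] using ht i
    · have h1 := mul_le_mul_of_nonneg_left (ht i) hj.le
      have h2 := mul_le_mul_of_nonneg_left (ht j) (neg_pos.2 hi).le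
      simp only [LinearMap.sub_apply, LinearMap.smul_apply, smul_eq_mul, Sum.elim_inr]
      linarith
  · intro h
    obtain ⟨t, hl, hu⟩ := exists_between_of_finite
      (fun i : {i // c i < 0} => (b i - g i y) / c i)
      (fun j : {j // 0 < c j} => (b j - g j y) / c j) (by
        rintro ⟨i, hi⟩ ⟨j, hj⟩
        have := h (.inr (⟨i, hi⟩, ⟨j, hj⟩))
        simp only [LinearMap.sub_apply, LinearMap.smul_apply, smul_eq_mul, Sum.elim_inr] at this
        show (b i - g i y) / c i ≤ (b j - g j y) / c j
        rw [le_div_iff₀ hj, div_mul_eq_mul_div, div_le_iff_of_neg hi]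
        linarith)
    refine ⟨t, fun i => ?_⟩
    rcases lt_trichotomy (c i) 0 with hi | hi | hi
    · have := hl ⟨i, hi⟩
      rw [div_le_iff_of_neg hi] at this
      linarith
    · have := h (.inl ⟨i, hi⟩)
      simpa [hi] using this
    · have := hu ⟨i, hi⟩
      rw [le_div_iff₀ hi] at this
      linarith

theorem exists_fin {n : ℕ} : ∀ {S : Set ((Fin n → ℝ) × E)}, IsPolyhedral S →
    IsPolyhedral {y | ∃ x, (x, y) ∈ S} := by
  induction n with
  | zero =>
    intro S hS
    convert hS.preimage (LinearMap.inr ℝ (Fin 0 → ℝ) E) using 1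
    ext y
    simp only [Set.mem_ofPred_eq, LinearMap.inr_apply]
    exact ⟨fun ⟨x, hx⟩ => by rwa [Subsingleton.elim x 0] at hx, fun h => ⟨0, h⟩⟩
  | succ n ih =>
    intro S hS
    let e := Fin.consLinearEquiv ℝ (fun _ : Fin (n + 1) => ℝ)
    let T : ℝ × ((Fin n → ℝ) × E) →ₗ[ℝ] (Fin (n + 1) → ℝ) × E :=
      LinearMap.prod
        (e.toLinearMap.comp (LinearMap.prod (LinearMap.fst _ _ _)
          ((LinearMap.fst _ _ _).comp (LinearMap.snd _ _ _))))
        ((LinearMap.snd _ _ _).comp (LinearMap.snd _ _ _))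
    convert ih (hS.preimage T).exists_real using 1
    ext y
    constructor
    · rintro ⟨x, hx⟩
      refine ⟨(e.symm x).2, (e.symm x).1, ?_⟩
      show (e (e.symm x), y) ∈ S
      rwa [e.apply_symm_apply]
    · rintro ⟨x, t, h⟩
      exact ⟨e (t, x), h⟩

/-- Projections of polyhedral sets along a finite-dimensional factor are polyhedral. -/
theorem exists_fst [FiniteDimensional ℝ F] {S : Set (F × E)} (hS : IsPolyhedral S) :
    IsPolyhedral {y | ∃ x, (x, y) ∈ S} := by
  let e := (Module.finBasis ℝ F).equivFun
  convert (hS.preimage (e.symm.toLinearMap.prodMap LinearMap.id)).exists_fin using 1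
  ext y
  constructor
  · rintro ⟨x, hx⟩
    exact ⟨e x, by simpa using hx⟩
  · rintro ⟨x, hx⟩
    exact ⟨e.symm x, hx⟩

theorem isClosed {E : Type*} [NormedAddCommGroup E] [NormedSpace ℝ E] [FiniteDimensional ℝ E]
    {S : Set E} (hS : IsPolyhedral S) : IsClosed S := by
  obtain ⟨ι, hι, f, b, rfl⟩ := hS
  simp only [Set.ofPred_forall]
  exact isClosed_iInter fun i =>
    isClosed_le (f i).continuous_of_finiteDimensional continuous_const

/-- A feasible linear program that is bounded below has an optimal solution. -/
theorem exists_isMinOn [FiniteDimensional ℝ E] {S : Set E} (hS : IsPolyhedral S)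
    (hne : S.Nonempty) {c : E → ℝ} (hc : IsLinearMap ℝ c) {β : ℝ} (hβ : ∀ x ∈ S, β ≤ c x) :
    ∃ x ∈ S, IsMinOn c S x := by
  have hlin : IsLinearMap ℝ fun p : E × ℝ => c p.1 - p.2 :=
    ⟨fun x y => by simp only [Prod.fst_add, Prod.snd_add, hc.map_add]; ring,
      fun r x => by simp only [Prod.smul_fst, Prod.smul_snd, hc.map_smul, smul_eq_mul]; ring⟩
  -- The cost levels that some feasible point meets form a polyhedral, hence closed, subset of the
  -- line, so it contains its infimum.
  have hR := ((hS.preimage (LinearMap.fst ℝ E ℝ)).inter (setOf_le hlin 0)).exists_fst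
  set R : Set ℝ := {r | ∃ x, _} with hRdef
  have hmem : ∀ r, r ∈ R ↔ ∃ x ∈ S, c x ≤ r := by
    intro r
    simp [hRdef]
  have hbdd : BddBelow R := ⟨β, fun r hr => by
    obtain ⟨x, hx, hxr⟩ := (hmem r).1 hr
    exact (hβ x hx).trans hxr⟩
  obtain ⟨x₁, hx₁⟩ := hne
  obtain ⟨x, hx, hxr⟩ := (hmem _).1
    (hR.isClosed.csInf_mem ⟨c x₁, (hmem _).2 ⟨x₁, hx₁, le_rfl⟩⟩ hbdd)
  exact ⟨x, hx, fun y hy => hxr.trans (csInf_le hbdd ((hmem _).2 ⟨y, hy, le_rfl⟩))⟩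

/-- The optimal value of a linear program is Lipschitz in the parameter, on the set of those
parameters for which the program is feasible. -/
theorem exists_lipschitz {Z : Type*} [NormedAddCommGroup Z] [NormedSpace ℝ Z]
    [FiniteDimensional ℝ Z] [FiniteDimensional ℝ F] {S : Set (F × Z)} (hS : IsPolyhedral S)
    {c : F → ℝ} (hc : IsLinearMap ℝ c) :
    ∃ L : ℝ, 0 ≤ L ∧ ∀ x z x' z', (x, z) ∈ S → (x', z') ∈ S →
      ∃ y, (y, z') ∈ S ∧ c y ≤ c x + L * ‖z' - z‖ := by
  have hlin : IsLinearMap ℝ fun p : F × (Z × ℝ) => c p.1 - p.2.2 :=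
    ⟨fun x y => by simp only [Prod.fst_add, Prod.snd_add, hc.map_add]; ring,
      fun r x => by simp only [Prod.smul_fst, Prod.smul_snd, hc.map_smul, smul_eq_mul]; ring⟩
  -- This projection is the epigraph of the value function.
  have hR := ((hS.preimage (LinearMap.id.prodMap (LinearMap.fst ℝ Z ℝ))).inter
    (setOf_le hlin 0)).exists_fst
  obtain ⟨ι, hι, f, b, hf⟩ := hR
  have hepi : ∀ z r, (∃ x, (x, z) ∈ S ∧ c x ≤ r) ↔ ∀ i, f i (z, r) ≤ b i := by
    intro z r
    have := Set.ext_iff.1 hf (z, r)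
    simpa using this
  set β : ι → ℝ := fun i => f i (0, 1) with hβ
  set α : ι → Z →L[ℝ] ℝ := fun i =>
    ((f i).comp (LinearMap.inl ℝ Z ℝ)).toContinuousLinearMap with hα
  have hfi : ∀ i z r, f i (z, r) = α i z + r * β i := by
    intro i z r
    have : ((z, r) : Z × ℝ) = (z, 0) + r • ((0, 1) : Z × ℝ) := by simp
    rw [this, map_add, map_smul]
    simp [hα, hβ]
  have : Fintype ι := Fintype.ofFinite ι
  have hL0 : ∀ i, 0 ≤ ‖α i‖ / |β i| := fun i => by positivity
  -- Rows with `β i = 0` contribute `0` to the sum, since division by zero gives zero.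
  refine ⟨∑ i, ‖α i‖ / |β i|, Finset.sum_nonneg fun i _ => hL0 i, fun x z x' z' hx hx' => ?_⟩
  set L := ∑ i, ‖α i‖ / |β i| with hL
  refine (hepi _ _).2 fun i => ?_
  have h1 := (hepi z (c x)).1 ⟨x, hx, le_rfl⟩ i
  have h2 : ∀ s, 0 ≤ s → f i (z', c x' + s) ≤ b i := fun s hs =>
    (hepi z' (c x' + s)).1 ⟨x', hx', by linarith⟩ i
  rw [hfi] at h1 ⊢
  simp only [hfi] at h2
  -- The epigraph is closed upwards over `z'`, so no row can bound `r` from above.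
  have hβi : β i ≤ 0 := by
    by_contra! hpos
    have h3 := h2 ((|b i - α i z' - c x' * β i| + 1) / β i) (by positivity)
    rw [add_mul, div_mul_cancel₀ _ hpos.ne'] at h3
    have := le_abs_self (b i - α i z' - c x' * β i)
    linarith
  -- A row without `r` only expresses feasibility of `z'`; in any other row, raising `r` by `L * ‖z'
  -- - z‖` absorbs the change of `α i`.
  rcases hβi.eq_or_lt with h0 | hneg
  · have h3 := h2 0 le_rfl
    simp only [h0, mul_zero] at h3 ⊢
    exact h3
  · have h3 : ‖α i‖ ≤ L * (-β i) := by
      have := Finset.single_le_sum (fun j _ => hL0 j) (Finset.mem_univ i)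
      rwa [← hL, abs_of_neg hneg, div_le_iff₀ (neg_pos.2 hneg)] at this
    have h4 : α i z' - α i z ≤ ‖α i‖ * ‖z' - z‖ := by
      rw [← map_sub]
      exact (le_abs_self _).trans ((α i).le_opNorm _)
    have h5 := mul_le_mul_of_nonneg_right h3 (norm_nonneg (z' - z))
    linarith

end IsPolyhedral

namespace FlexMarket

/-! ### Linear structure of the network and DSO problems. -/

namespace Network

variable (N : Network)

theorem isLinearMap_cost : IsLinearMap ℝ N.cost :=
  ⟨fun x y => by
    simp only [cost, Prod.fst_add, Prod.snd_add, Pi.add_apply, mul_add, Finset.sum_add_distrib]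
    ring,
  fun r x => by
    simp only [cost, Prod.smul_fst, Prod.smul_snd, Pi.smul_apply, smul_eq_mul, mul_sub,
      Finset.mul_sum, mul_left_comm]⟩

theorem isLinearMap_nodal (k : Fin N.nBus) : IsLinearMap ℝ fun x => N.nodal x k :=
  ⟨fun x y => by
    simp only [nodal, Prod.fst_add, Prod.snd_add, Pi.add_apply, Finset.sum_add_distrib]
    ring,
  fun r x => by
    simp only [nodal, Prod.smul_fst, Prod.smul_snd, Pi.smul_apply, smul_eq_mul, mul_sub,
      Finset.mul_sum]⟩

theorem isPolyhedral_flowLimits : IsPolyhedral {x | N.FlowLimits x} :=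
  IsPolyhedral.iInter fun l => IsPolyhedral.setOf_mem_Icc
    ⟨fun x y => by simp [Matrix.mulVec_add], fun r x => by simp [Matrix.mulVec_smul]⟩ _ _

theorem isPolyhedral_bidLimits : IsPolyhedral {x | N.BidLimits x} :=
  .inter
    (.iInter fun _ => .setOf_mem_Icc ⟨fun _ _ => rfl, fun _ _ => rfl⟩ _ _)
    (.iInter fun _ => .setOf_mem_Icc ⟨fun _ _ => rfl, fun _ _ => rfl⟩ _ _)

/-- Bid limits alone bound the cost below, so the unbounded injections do no harm to attainment. -/
theorem le_cost {x : N.Decision} (hx : N.BidLimits x) : -∑ n, N.cDown n * N.dMax n ≤ N.cost x := by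
  have h1 : 0 ≤ ∑ n, N.cUp n * x.1 n :=
    Finset.sum_nonneg fun n _ => mul_nonneg (N.cUp_pos n).le (hx.1 n).1
  have h2 : ∑ n, N.cDown n * x.2.1 n ≤ ∑ n, N.cDown n * N.dMax n :=
    Finset.sum_le_sum fun n _ => mul_le_mul_of_nonneg_left (hx.2 n).2 (N.cDown_pos n).le
  unfold cost
  linarith

end Network

namespace DSO

variable (D : DSO)

theorem isPolyhedral_gridFeasible :
    IsPolyhedral {v : D.Decision × ℝ | D.GridFeasible v.1 v.2} := by
  have hbal : IsPolyhedral {v : D.Decision × ℝ | D.Balance v.1 v.2} := by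
    refine IsPolyhedral.iInter fun k => IsPolyhedral.setOf_eq ⟨fun x y => ?_, fun r x => ?_⟩ _
    · rw [Prod.fst_add, (D.isLinearMap_nodal k).map_add]
      split_ifs
      · rw [Prod.snd_add]
        ring
      · simp
    · rw [Prod.smul_fst, (D.isLinearMap_nodal k).map_smul]
      split_ifs <;> simp [mul_sub]
  exact hbal.inter ((D.isPolyhedral_flowLimits.preimage (LinearMap.fst ℝ _ ℝ)).inter
    (D.isPolyhedral_bidLimits.preimage (LinearMap.fst ℝ _ ℝ)))

theorem isPolyhedral_feasible : IsPolyhedral {v : D.Decision × ℝ | D.Feasible v.1 v.2} :=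
  D.isPolyhedral_gridFeasible.inter
    (IsPolyhedral.setOf_mem_Icc ⟨fun _ _ => rfl, fun _ _ => rfl⟩ _ _)

theorem objective_zero (x : D.Decision) (z : ℝ) : D.objective 0 x z = D.cost x := by
  simp [objective]

theorem exists_solvesFixed {z : ℝ} (h : ∃ x, D.GridFeasible x z) : ∃ x, D.SolvesFixed z x := by
  obtain ⟨x₁, hx₁⟩ := h
  -- The flow stays a variable and is pinned by an equation, so the joint polyhedron can be reused.
  have hS := D.isPolyhedral_gridFeasible.inter
    (IsPolyhedral.setOf_eq (f := fun v : D.Decision × ℝ => v.2) ⟨fun _ _ => rfl, fun _ _ => rfl⟩ z)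
  have hc : IsLinearMap ℝ fun v : D.Decision × ℝ => D.cost v.1 :=
    ⟨fun x y => D.isLinearMap_cost.map_add _ _, fun r x => D.isLinearMap_cost.map_smul _ _⟩
  obtain ⟨⟨x, z'⟩, ⟨hx, rfl⟩, hmin⟩ := hS.exists_isMinOn ⟨(x₁, z), hx₁, rfl⟩ hc
    (fun v hv => D.le_cost hv.1.2.2)
  refine ⟨x, hx, fun y hy => ?_⟩
  simpa only [Set.mem_ofPred_eq, objective_zero] using hmin (a := (y, z')) ⟨hy, rfl⟩

theorem rsf_le {z : ℝ} {x : D.Decision} (hx : D.GridFeasible x z) : D.rsf z ≤ D.cost x := by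
  rw [← D.objective_zero x z]
  refine csInf_le ⟨-∑ n, D.cDown n * D.dMax n, ?_⟩ ⟨x, hx, rfl⟩
  rintro _ ⟨y, hy, rfl⟩
  simpa only [objective_zero] using D.le_cost hy.2.2

theorem SolvesFixed.rsf_eq {D : DSO} {z : ℝ} {x : D.Decision} (hx : D.SolvesFixed z x) :
    D.rsf z = D.cost x := by
  refine le_antisymm (D.rsf_le hx.1) (le_csInf ⟨_, x, hx.1, rfl⟩ ?_)
  rintro _ ⟨y, hy, rfl⟩
  rw [← D.objective_zero x z]
  exact hx.2 hy

/-- The interface flows for which the local market problem is feasible form an interval. -/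
theorem ordConnected_gridFeasible : {z | ∃ x, D.GridFeasible x z}.OrdConnected := by
  obtain ⟨ι, _, f, b, hf⟩ := D.isPolyhedral_gridFeasible.exists_fst
  change {z | ∃ x, D.GridFeasible x z} = _ at hf
  rw [hf]
  refine Convex.ordConnected ?_
  simp only [Set.ofPred_forall]
  exact convex_iInter fun i => convex_halfSpace_le (f i).isLinear _

end DSO

/-! ### Rounding to feasible grid points. -/

namespace Grid

variable {a b : ℝ} (Z : Grid a b)

theorem step_nonneg : 0 ≤ Z.step := Real.iSup_nonneg fun _ => abs_nonneg _

theorem sub_le_step (i : Fin Z.n) : Z.pt i.succ - Z.pt i.castSucc ≤ Z.step :=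
  (le_abs_self _).trans (le_ciSup
    (f := fun i : Fin Z.n => |Z.pt i.succ - Z.pt i.castSucc|) (Set.finite_range _).bddAbove i)

/-- In an interval that contains a grid point, every point is close to a grid point of that
interval. -/
theorem exists_abs_sub_le {I : Set ℝ} (hI : I.OrdConnected) {i₀ : Fin (Z.n + 1)}
    (hi₀ : Z.pt i₀ ∈ I) {δ : ℝ} (hδ : Z.step ≤ δ) (ha : Z.pt 0 - a ≤ δ)
    (hb : b - Z.pt (Fin.last Z.n) ≤ δ) {z : ℝ} (hz : z ∈ I) (hzab : z ∈ Set.Icc a b) :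
    ∃ i, Z.pt i ∈ I ∧ |Z.pt i - z| ≤ δ := by
  rcases le_total (Z.pt i₀) z with h | h
  -- The last grid point not above `z` lies between `Z.pt i₀` and `z`, hence in `I`. Its successor
  -- exceeds `z`; if there is none, the bound at the end `b` applies.
  · obtain ⟨i, hi, hmax⟩ := (Set.toFinite {i | Z.pt i ≤ z}).exists_maximal ⟨i₀, h⟩
    have hi₀i : i₀ ≤ i := by
      rcases le_total i₀ i with h' | h'
      · exact h'
      · exact hmax h h'
    refine ⟨i, hI.out hi₀ hz ⟨Z.strictMono.monotone hi₀i, hi⟩, ?_⟩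
    rw [abs_sub_comm, abs_of_nonneg (sub_nonneg.2 hi)]
    induction i using Fin.lastCases with
    | last => linarith [hzab.2]
    | cast j =>
      have : z < Z.pt j.succ := by
        by_contra! hle
        exact absurd (hmax hle (Fin.castSucc_lt_succ).le) (Fin.castSucc_lt_succ).not_ge
      linarith [Z.sub_le_step j]
  · obtain ⟨i, hi, hmin⟩ := (Set.toFinite {i | z ≤ Z.pt i}).exists_minimal ⟨i₀, h⟩
    have hii₀ : i ≤ i₀ := by
      rcases le_total i i₀ with h' | h'
      · exact h'
      · exact hmin h h'
    refine ⟨i, hI.out hz hi₀ ⟨hi, Z.strictMono.monotone hii₀⟩, ?_⟩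
    rw [abs_of_nonneg (sub_nonneg.2 hi)]
    induction i using Fin.cases with
    | zero => linarith [hzab.1]
    | succ j =>
      have : Z.pt j.castSucc < z := by
        by_contra! hle
        exact absurd (hmin hle (Fin.castSucc_lt_succ).le) (Fin.castSucc_lt_succ).not_ge
      linarith [Z.sub_le_step j]

end Grid

/-! ### The common market problem and the outcomes of bid aggregation. -/

namespace Market

variable (M : Market)

theorem isPolyhedral_tsoFeasible :
    IsPolyhedral {v : M.tso.Decision × (Fin M.nD → ℝ) | M.TsoFeasible v.1 v.2} := by
  have hbal : IsPolyhedral {v : M.tso.Decision × (Fin M.nD → ℝ) |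
      ∀ k, M.tso.nodal v.1 k + (∑ m with M.conn m = k, v.2 m) = M.tso.base k} := by
    refine IsPolyhedral.iInter fun k => IsPolyhedral.setOf_eq ⟨fun x y => ?_, fun r x => ?_⟩ _
    · rw [Prod.fst_add, (M.tso.isLinearMap_nodal k).map_add]
      simp only [Prod.snd_add, Pi.add_apply, Finset.sum_add_distrib]
      ring
    · rw [Prod.smul_fst, (M.tso.isLinearMap_nodal k).map_smul]
      simp only [Prod.smul_snd, Pi.smul_apply, smul_eq_mul, mul_add, Finset.mul_sum]
  exact hbal.inter (.inter
    (M.tso.isPolyhedral_flowLimits.preimage (LinearMap.fst ℝ _ (Fin M.nD → ℝ)))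
    (M.tso.isPolyhedral_bidLimits.preimage (LinearMap.fst ℝ _ (Fin M.nD → ℝ))))

/-- The decisions of all operators, without the interface flows. -/
abbrev Local (M : Market) : Type :=
  M.tso.Decision × ((m : Fin M.nD) → (M.dso m).Decision)

/-- The total cost as a function of the decisions of the operators. -/
def localCost (M : Market) (x : M.Local) : ℝ :=
  M.tso.cost x.1 + ∑ m, (M.dso m).cost (x.2 m)

theorem isLinearMap_localCost : IsLinearMap ℝ M.localCost :=
  ⟨fun x y => by
    simp only [localCost, Prod.fst_add, Prod.snd_add, Pi.add_apply,
      (Network.isLinearMap_cost _).map_add, Finset.sum_add_distrib]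
    ring,
  fun r x => by
    simp only [localCost, Prod.smul_fst, Prod.smul_snd, Pi.smul_apply,
      (Network.isLinearMap_cost _).map_smul, smul_eq_mul, mul_add, Finset.mul_sum]⟩

theorem isPolyhedral_common : IsPolyhedral {v : M.Local × (Fin M.nD → ℝ) |
    (v.1.1, v.1.2, v.2) ∈ M.commonFeasible} := by
  let T : M.Local × (Fin M.nD → ℝ) →ₗ[ℝ] M.tso.Decision × (Fin M.nD → ℝ) :=
    (LinearMap.fst ℝ _ _).prodMap LinearMap.id
  let U (m : Fin M.nD) : M.Local × (Fin M.nD → ℝ) →ₗ[ℝ] (M.dso m).Decision × ℝ :=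
    ((LinearMap.proj m).comp (LinearMap.snd ℝ _ _)).prodMap (LinearMap.proj m)
  exact (M.isPolyhedral_tsoFeasible.preimage T).inter
    (IsPolyhedral.iInter fun m => (M.dso m).isPolyhedral_feasible.preimage (U m))

theorem exists_isLeast_totalCost (h : M.commonFeasible.Nonempty) :
    ∃ J, IsLeast (M.totalCost '' M.commonFeasible) J := by
  obtain ⟨w, hw⟩ := h
  have hc : IsLinearMap ℝ fun v : M.Local × (Fin M.nD → ℝ) => M.localCost v.1 :=
    ⟨fun x y => M.isLinearMap_localCost.map_add _ _,
      fun r x => M.isLinearMap_localCost.map_smul _ _⟩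
  obtain ⟨v, hv, hmin⟩ := M.isPolyhedral_common.exists_isMinOn ⟨((w.1, w.2.1), w.2.2), hw⟩ hc
    (fun v hv => add_le_add (M.tso.le_cost hv.1.2.2)
      (Finset.sum_le_sum fun m _ => (M.dso m).le_cost (hv.2 m).1.2.2))
  refine ⟨_, ⟨_, hv, rfl⟩, ?_⟩
  rintro _ ⟨y, hy, rfl⟩
  exact hmin (a := ((y.1, y.2.1), y.2.2)) hy

theorem exists_isMinOn_tso_cost {z : Fin M.nD → ℝ} (h : ∃ x₀, M.TsoFeasible x₀ z) :
    ∃ x₀, M.TsoFeasible x₀ z ∧ ∀ y, M.TsoFeasible y z → M.tso.cost x₀ ≤ M.tso.cost y := by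
  obtain ⟨x₁, hx₁⟩ := h
  have hS := M.isPolyhedral_tsoFeasible.inter (IsPolyhedral.iInter fun m : Fin M.nD =>
    IsPolyhedral.setOf_eq (f := fun v : M.tso.Decision × (Fin M.nD → ℝ) => v.2 m)
      ⟨fun _ _ => rfl, fun _ _ => rfl⟩ (z m))
  have hc : IsLinearMap ℝ fun v : M.tso.Decision × (Fin M.nD → ℝ) => M.tso.cost v.1 :=
    ⟨fun x y => M.tso.isLinearMap_cost.map_add _ _, fun r x => M.tso.isLinearMap_cost.map_smul _ _⟩
  obtain ⟨⟨x, z'⟩, ⟨hx, hz'⟩, hmin⟩ := hS.exists_isMinOn ⟨(x₁, z), hx₁, fun _ => rfl⟩ hc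
    (fun v hv => M.tso.le_cost hv.1.2.2)
  obtain rfl : z' = z := funext hz'
  exact ⟨x, hx, fun y hy => hmin (a := (y, z')) ⟨hy, fun _ => rfl⟩⟩

variable {M}

theorem feasible_of_mem_feasibleFlows {Z : M.Discretization} {m : Fin M.nD} {z : ℝ}
    (hz : z ∈ (M.dso m).feasibleFlows (Z m)) : ∃ x, (M.dso m).Feasible x z := by
  obtain ⟨⟨i, rfl⟩, x, hx⟩ := hz
  exact ⟨x, hx, (Z m).mem i⟩

/-- Only finitely many flow vectors compete; each gets its cheapest TSO decision, and the best pair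
is selected. -/
theorem TsoSelfSufficient.exists_outcome (hTso : M.TsoSelfSufficient) {Z : M.Discretization}
    (hne : ∀ m, ((M.dso m).feasibleFlows (Z m)).Nonempty) :
    ∃ w, M.IsBidAggregationOutcome Z w := by
  have hfin : (Set.univ.pi fun m => (M.dso m).feasibleFlows (Z m)).Finite :=
    Set.Finite.pi fun m => (Set.finite_range (Z m).pt).subset fun z hz => hz.1
  have hx : ∀ z : Fin M.nD → ℝ, ∃ x₀, (∀ m, z m ∈ (M.dso m).feasibleFlows (Z m)) →
      M.TsoFeasible x₀ z ∧ ∀ y, M.TsoFeasible y z → M.tso.cost x₀ ≤ M.tso.cost y := by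
    intro z
    by_cases hz : ∀ m, z m ∈ (M.dso m).feasibleFlows (Z m)
    · obtain ⟨x₀, hx₀⟩ := M.exists_isMinOn_tso_cost
        (hTso z fun m => feasible_of_mem_feasibleFlows (hz m))
      exact ⟨x₀, fun _ => hx₀⟩
    · exact ⟨0, fun h => absurd h hz⟩
  choose X hX using hx
  obtain ⟨z, hz, hmin⟩ := Set.exists_min_image _ (fun z => M.rsfObjective (X z, z)) hfin
    (Set.univ_pi_nonempty_iff.2 hne)
  replace hz : ∀ m, z m ∈ (M.dso m).feasibleFlows (Z m) := fun m => hz m trivial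
  choose x hx using fun m => (M.dso m).exists_solvesFixed (hz m).2
  refine ⟨(X z, x, z), ⟨(hX z hz).1, hz⟩, ?_, hx⟩
  rintro ⟨y, z'⟩ ⟨hy, hz'⟩
  have h1 := hmin z' fun m _ => hz' m
  have h2 := (hX z' hz').2 y hy
  simp only [rsfObjective, Set.mem_ofPred_eq] at h1 ⊢
  linarith

theorem IsBidAggregationOutcome.mem_commonFeasible {Z : M.Discretization} {w : M.Joint}
    (hw : M.IsBidAggregationOutcome Z w) : w ∈ M.commonFeasible := by
  refine ⟨hw.1.1, fun m => ⟨(hw.2.2 m).1, ?_⟩⟩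
  obtain ⟨i, hi⟩ := (hw.1.2 m).1
  exact hi ▸ (Z m).mem i

/-- An outcome costs at most as much as any joint decision on the discretized interface flows. -/
theorem IsBidAggregationOutcome.totalCost_le {Z : M.Discretization} {w v : M.Joint}
    (hw : M.IsBidAggregationOutcome Z w) (hv : v ∈ M.commonFeasible)
    (hvZ : ∀ m, v.2.2 m ∈ Set.range (Z m).pt) : M.totalCost w ≤ M.totalCost v := by
  have h1 : M.rsfObjective (w.1, w.2.2) ≤ M.rsfObjective (v.1, v.2.2) :=
    hw.2.1 ⟨hv.1, fun m => ⟨hvZ m, _, (hv.2 m).1⟩⟩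
  have h2 : M.totalCost w = M.rsfObjective (w.1, w.2.2) := by
    simp only [totalCost, rsfObjective, (hw.2.2 _).rsf_eq]
  rw [h2]
  exact h1.trans (add_le_add le_rfl
    (Finset.sum_le_sum fun m _ => (M.dso m).rsf_le (hv.2 m).1))

theorem step_le_maxStep (Z : M.Discretization) (m : Fin M.nD) : (Z m).step ≤ M.maxStep Z :=
  le_ciSup (f := fun m => (Z m).step) (Set.finite_range _).bddAbove m

theorem maxStep_nonneg (Z : M.Discretization) : 0 ≤ M.maxStep Z :=
  Real.iSup_nonneg fun m => (Z m).step_nonneg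

end Market

end FlexMarket

open FlexMarket in
theorem mainTheorem1 (M : FlexMarket.Market)
    (hDso : ∀ m, ∃ x z, (M.dso m).Feasible x z)
    (hTso : M.TsoSelfSufficient) :
    ∃ Jopt C : ℝ, IsLeast (M.totalCost '' M.commonFeasible) Jopt ∧ 0 ≤ C ∧
      ∀ Z : M.Discretization, M.Covers Z →
        ((∀ m, ((M.dso m).feasibleFlows (Z m)).Nonempty) →
          ∃ w, M.IsBidAggregationOutcome Z w) ∧
        ∀ w, M.IsBidAggregationOutcome Z w →
          0 ≤ M.totalCost w - Jopt ∧ M.totalCost w - Jopt ≤ C * M.maxStep Z := by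
  choose x₁ z₁ h₁ using hDso
  obtain ⟨y₁, hy₁⟩ := hTso z₁ fun m => ⟨x₁ m, h₁ m⟩
  obtain ⟨J, hJ⟩ := M.exists_isLeast_totalCost ⟨(y₁, x₁, z₁), hy₁, h₁⟩
  obtain ⟨L, hL0, hL⟩ := M.isPolyhedral_common.exists_lipschitz M.isLinearMap_localCost
  refine ⟨J, L, hJ, hL0, fun Z hZ => ⟨hTso.exists_outcome, fun w hw =>
    ⟨sub_nonneg.2 (hJ.2 ⟨w, hw.mem_commonFeasible, rfl⟩), ?_⟩⟩⟩
  obtain ⟨⟨wo, ho, rfl⟩, -⟩ := hJ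
  have hnear : ∀ m, ∃ i, (∃ x, (M.dso m).GridFeasible x ((Z m).pt i)) ∧
      |(Z m).pt i - wo.2.2 m| ≤ M.maxStep Z := by
    intro m
    -- The flow of the outcome itself is the feasible grid point that the rounding needs.
    obtain ⟨⟨i₀, hi₀⟩, hx⟩ := hw.1.2 m
    rw [← hi₀] at hx
    exact (Z m).exists_abs_sub_le (M.dso m).ordConnected_gridFeasible hx (Market.step_le_maxStep Z m)
      (hZ m).1 (hZ m).2 ⟨_, (ho.2 m).1⟩ (ho.2 m).2
  choose i hi hdist using hnear
  choose x hx using hi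
  have hfeas : ∀ m, (M.dso m).Feasible (x m) ((Z m).pt (i m)) := fun m => ⟨hx m, (Z m).mem _⟩
  obtain ⟨x₀, hx₀⟩ := hTso (fun m => (Z m).pt (i m)) fun m => ⟨x m, hfeas m⟩
  -- `(x₀, x)` only certifies feasibility at the rounded flows; `y` is the decision with controlled
  -- cost.
  obtain ⟨y, hy, hcost⟩ := hL (wo.1, wo.2.1) wo.2.2 (x₀, x) (fun m => (Z m).pt (i m)) ho
    ⟨hx₀, hfeas⟩
  have hle : M.totalCost w ≤ M.localCost y := hw.totalCost_le hy fun m => ⟨i m, rfl⟩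
  have hnorm : ‖(fun m => (Z m).pt (i m)) - wo.2.2‖ ≤ M.maxStep Z :=
    (pi_norm_le_iff_of_nonneg (Market.maxStep_nonneg Z)).2 hdist
  have hmul := mul_le_mul_of_nonneg_left hnorm hL0
  have heq : M.localCost (wo.1, wo.2.1) = M.totalCost wo := rfl
  linarith
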